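/- Let $\theta(t)=\theta(t,\tau)=-i\sum_{n\in\mathbb Z}(-1)^n e^{\pi i(n+1/2)^2\tau+2\pi i(n+1/2)t}$ be the odd Jacobi theta function, $\operatorname{Im}\tau>0$. **(1)** Let $Y$ be a smooth complete toric variety of dimension $n$ with lattice $N$ and fan $\Sigma_Y$, and let $\mu:X\to Y$ be a composition of toric blow-ups (blow-ups along torus-invariant orbit closures). That is, the fan $\Sigma_X$ in $N$ arises from $\Sigma_Y$ by finitely many star subdivisions: at each step one chooses a cone $T$ of dimension $\ge 2$ of the current fan and adds the ray through the sum of the primitive generators of $T$. To each ray $a$ of $\Sigma_Y$ (identified with its primitive generator) let a real number $\alpha_a<0$ be given, and let $f_\alpha:N_{\mathbb R}\to\mathbb R$ be the function that is linear on each cone of $\Sigma_Y$ with $f_\alpha(a)=\alpha_a$ for all rays $a$. For each ray $b$ of $\Sigma_X$ put $\beta_b=f_\alpha(b)$; the family $\beta=\mu^*\alpha$ is the pull-back of $\alpha$. For an $n$-dimensional cone $C_i$ of $\Sigma_X$ let $x_{i1},\dots,x_{in}\in\operatorname{Hom}(N,\mathbb Z)$ be the basis dual to the primitive generators of $C_i$,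 and let $\beta_{i1},\dots,\beta_{in}$ be the coefficients belonging to these generators. Define $y_{ij}$ and $\alpha_{ij}$ in the same way for the $n$-dimensional cones $C_i'$ of $\Sigma_Y$. Then $$\sum_{C_i\subset\Sigma_X}\prod_{j=1}^n\frac{\theta(x_{ij}+\beta_{ij}z)}{\theta(x_{ij})\,\theta(\beta_{ij}z)}=\sum_{C_i'\subset\Sigma_Y}\prod_{j=1}^n\frac{\theta(y_{ij}+\alpha_{ij}z)}{\theta(y_{ij})\,\theta(\alpha_{ij}z)}$$ as meromorphic functions on $N_{\mathbb C}\times\mathbb C$, that is, at every point $(u,z)\in N_{\mathbb C}\times\mathbb C$ at which none of the denominators on either side vanishes. **(2)** Let $n\ge 1$, let $\alpha_1,\dots,\alpha_n<1$ be real numbers and put $\alpha_0=\sum_{i=1}^n\alpha_i+(1-n)$. Then $$\sum_{i=1}^n\ \prod_{j\ne i}\frac{\theta(u_j-u_i+(\alpha_j-1)z)}{\theta(u_j-u_i)\,\theta((\alpha_j-1)z)}\cdot\frac{\theta(u_i+(\alpha_0-1)z)}{\theta(u_i)\,\theta((\alpha_0-1)z)}=\prod_{j=1}^n\frac{\theta(u_j+(\alpha_j-1)z)}{\theta(u_j)\,\theta((\alpha_j-1)z)}$$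 for all $(u_1,\dots,u_n,z)\in\mathbb C^n\times\mathbb C$ at which no denominator vanishes. -/

import Mathlib

open scoped TensorProduct

noncomputable section

/-! ### The Jacobi theta function -/

/-- The (odd) Jacobi theta function
`θ(t, τ) = -i ∑_{n ∈ ℤ} (-1)^n exp(πi (n + 1/2)² τ + 2πi (n + 1/2) t)`, `Im τ > 0`,
which vanishes exactly for `t ∈ ℤ + ℤτ`. It is written through Mathlib's two-variable theta
series; the expansion above is `hasSum_thetaOdd`. -/
def thetaOdd (t τ : ℂ) : ℂ :=
  -Complex.I * Complex.exp (Real.pi * Complex.I * τ / 4 + Real.pi * Complex.I * t) *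
    jacobiTheta₂ (t + τ / 2 + 1 / 2) τ

theorem hasSum_thetaOdd (t τ : ℂ) (hτ : 0 < τ.im) :
    HasSum (fun n : ℤ => -Complex.I * ((-1 : ℂ) ^ n *
      Complex.exp (Real.pi * Complex.I * ((n : ℂ) + 1 / 2) ^ 2 * τ +
        2 * Real.pi * Complex.I * ((n : ℂ) + 1 / 2) * t))) (thetaOdd t τ) := by
  have h := (hasSum_jacobiTheta₂_term (t + τ / 2 + 1 / 2) hτ).mul_left
    (-Complex.I * Complex.exp (Real.pi * Complex.I * τ / 4 + Real.pi * Complex.I * t))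
  refine h.congr_fun (fun n => ?_)
  rw [← Complex.exp_pi_mul_I, ← Complex.exp_int_mul, jacobiTheta₂_term,
    mul_assoc (-Complex.I), ← Complex.exp_add, ← Complex.exp_add]
  congr 2
  ring

/-- The quotient `θ(x + w) / (θ(x) θ(w))`. -/
def thetaQuot (τ x w : ℂ) : ℂ :=
  thetaOdd (x + w) τ / (thetaOdd x τ * thetaOdd w τ)

/-! ### Lattices and cones -/

section Lattice

variable {N : Type*} [AddCommGroup N]

/-- The finite set `B` is a `ℤ`-basis of the lattice `N`. -/
def IsLatticeBasis (B : Finset N) : Prop :=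
  LinearIndepOn ℤ id (B : Set N) ∧ Submodule.span ℤ (B : Set N) = ⊤

/-- For a `ℤ`-basis `S` of `N` and `v ∈ S`: the form `x ∈ Hom(N, ℤ)` of the dual basis
that belongs to `v`, that is `x v = 1` and `x w = 0` for the other `w ∈ S`
(the value `0` if `S` is not a basis or `v ∉ S` is never used). -/
def dualForm (S : Finset N) (v : N) : N →ₗ[ℤ] ℤ :=
  open Classical in
  if h : IsLatticeBasis S ∧ v ∈ S then
    (Module.Basis.mk (v := fun w : (S : Set N) => (w : N)) h.1.1
      (by simpa using h.1.2.ge)).coord ⟨v, h.2⟩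
  else 0

theorem dualForm_apply {S : Finset N} (hS : IsLatticeBasis S) {v : N} (hv : v ∈ S) {w : N}
    (hw : w ∈ S) : dualForm S v w = open Classical in if w = v then 1 else 0 := by
  classical
  have h : IsLatticeBasis S ∧ v ∈ S := ⟨hS, hv⟩
  rw [dualForm, dif_pos h]
  set b := Module.Basis.mk (v := fun w : (S : Set N) => (w : N)) h.1.1
    (by simpa using h.1.2.ge) with hb
  have hbw : b ⟨w, hw⟩ = w := by simp [hb]
  have h2 := b.repr_self ⟨w, hw⟩
  rw [hbw] at h2
  rw [Module.Basis.coord_apply, h2, Finsupp.single_apply]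
  simp

/-- The `ℂ`-linear extension of `x ∈ Hom(N, ℤ)` to `N_ℂ = ℂ ⊗ N`, evaluated at `u`. -/
def evalC (x : N →ₗ[ℤ] ℤ) (u : ℂ ⊗[ℤ] N) : ℂ :=
  TensorProduct.rid ℤ ℂ (x.lTensor ℂ u)

/-- The cone in `N_ℝ = ℝ ⊗ N` generated by a finite set of lattice vectors. -/
def latticeCone (S : Finset N) : PointedCone ℝ (ℝ ⊗[ℤ] N) :=
  PointedCone.hull ℝ ((fun v : N => (1 : ℝ) ⊗ₜ[ℤ] v) '' (S : Set N))

/-- The point `∑ c_v v` of `N_ℝ`. -/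
def realComb : (N →₀ ℝ) →ₗ[ℝ] (ℝ ⊗[ℤ] N) :=
  Finsupp.linearCombination ℝ (fun v : N => (1 : ℝ) ⊗ₜ[ℤ] v)

theorem mem_latticeCone {S : Finset N} {x : ℝ ⊗[ℤ] N} :
    x ∈ latticeCone S ↔
      ∃ c : N →₀ ℝ, (∀ v, 0 ≤ c v) ∧ c.support ⊆ S ∧ realComb c = x := by
  classical
  rw [latticeCone, PointedCone.hull, Submodule.mem_span_image_finset_iff_exists_fun']
  constructor
  · rintro ⟨c, rfl⟩
    refine ⟨Finsupp.onFinset S (fun v => if v ∈ S then (c v : ℝ) else 0)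
      (fun v hv => by by_contra h; simp [h] at hv), fun v => ?_,
      Finsupp.support_onFinset_subset, ?_⟩
    · simp only [Finsupp.onFinset_apply]
      split_ifs
      · exact (c v).2
      · exact le_rfl
    · rw [realComb, Finsupp.linearCombination_apply,
        Finsupp.sum_of_support_subset _ Finsupp.support_onFinset_subset _ (by simp)]
      refine Finset.sum_congr rfl fun v hv => ?_
      simp [hv]
  · rintro ⟨c, hc, hS, rfl⟩
    refine ⟨fun v => ⟨c v, hc v⟩, ?_⟩
    rw [realComb, Finsupp.linearCombination_apply, Finsupp.sum_of_support_subset _ hS _ (by simp)]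
    rfl

theorem IsLatticeBasis.realComb_inj {B : Finset N} (hB : IsLatticeBasis B) {c d : N →₀ ℝ}
    (hc : c.support ⊆ B) (hd : d.support ⊆ B) (h : realComb c = realComb d) : c = d := by
  have hli : LinearIndepOn ℝ (fun v : N => (1 : ℝ) ⊗ₜ[ℤ] v) (B : Set N) := by
    have := (((Module.Basis.mk (v := fun w : (B : Set N) => (w : N)) hB.1
      (by simpa using hB.2.ge))).baseChange ℝ).linearIndependent
    have h2 : (fun v : (B : Set N) => (1 : ℝ) ⊗ₜ[ℤ] (v : N)) =
        ⇑((((Module.Basis.mk (v := fun w : (B : Set N) => (w : N)) hB.1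
          (by simpa using hB.2.ge))).baseChange ℝ)) := by
      ext v
      simp
    rw [LinearIndepOn, h2]
    exact this
  exact linearIndepOn_iffₛ.1 hli c (by simpa [Finsupp.mem_supported] using hc) d
    (by simpa [Finsupp.mem_supported] using hd) h

theorem IsLatticeBasis.card_eq {B : Finset N} (hB : IsLatticeBasis B) :
    B.card = Module.finrank ℤ N := by
  rw [Module.finrank_eq_card_basis (Module.Basis.mk (v := fun w : (B : Set N) => (w : N)) hB.1
      (by simpa using hB.2.ge))]
  simp

end Lattice

/-! ### Smooth fans -/

/-- A smooth fan in the lattice `N`, that is, the fan of a smooth toric variety with lattice of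
one-parameter subgroups `N`. A smooth cone is generated by a part of a `ℤ`-basis of `N`, and it is
recorded here by this finite set of primitive generators; its faces are then the cones on the
subsets. -/
structure SmoothFan (N : Type*) [AddCommGroup N] where
  /-- The sets of primitive generators of the cones of the fan. -/
  cones : Finset (Finset N)
  empty_mem : ∅ ∈ cones
  face_mem : ∀ S ∈ cones, ∀ R ⊆ S, R ∈ cones
  smooth : ∀ S ∈ cones, ∃ B : Finset N, IsLatticeBasis B ∧ S ⊆ B
  inter : ∀ S ∈ cones, ∀ R ∈ cones, open Classical in
    latticeCone S ⊓ latticeCone R = latticeCone (S ∩ R)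

namespace SmoothFan

variable {N : Type*} [AddCommGroup N]

/-- The fan is complete: its cones cover `N_ℝ` (the toric variety is complete). -/
def IsComplete (X : SmoothFan N) : Prop :=
  ∀ x : ℝ ⊗[ℤ] N, ∃ S ∈ X.cones, x ∈ latticeCone S

/-- The primitive generators of the one-dimensional cones. -/
def rays (X : SmoothFan N) : Set N := {v | {v} ∈ X.cones}

/-- The cones of dimension `n = rank N`. -/
def maxCones (X : SmoothFan N) : Finset (Finset N) :=
  X.cones.filter (fun S => S.card = Module.finrank ℤ N)

theorem isLatticeBasis_of_mem_maxCones (X : SmoothFan N) {S : Finset N} (hS : S ∈ X.maxCones) :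
    IsLatticeBasis S := by
  rw [maxCones, Finset.mem_filter] at hS
  obtain ⟨B, hB, hSB⟩ := X.smooth S hS.1
  rwa [Finset.eq_of_subset_of_card_le hSB (by rw [hS.2, hB.card_eq])]

/-- A point of the support has only one expression as a nonnegative combination of generators of
a cone of the fan. -/
theorem realComb_inj (X : SmoothFan N) {S R : Finset N} (hS : S ∈ X.cones) (hR : R ∈ X.cones)
    {c d : N →₀ ℝ} (hc : ∀ v, 0 ≤ c v) (hd : ∀ v, 0 ≤ d v) (hcS : c.support ⊆ S)
    (hdR : d.support ⊆ R) (h : realComb c = realComb d) : c = d := by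
  classical
  have h1 : realComb c ∈ latticeCone S ⊓ latticeCone R :=
    Submodule.mem_inf.2 ⟨mem_latticeCone.2 ⟨c, hc, hcS, rfl⟩, mem_latticeCone.2 ⟨d, hd, hdR, h.symm⟩⟩
  have hi : latticeCone S ⊓ latticeCone R = latticeCone (S ∩ R) := by
    convert X.inter S hS R hR
  rw [hi] at h1
  obtain ⟨e, -, heS, he⟩ := mem_latticeCone.1 h1
  obtain ⟨B, hB, hSB⟩ := X.smooth S hS
  obtain ⟨B', hB', hRB⟩ := X.smooth R hR
  have e1 : e = c := hB.realComb_inj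
    (heS.trans (Finset.inter_subset_left.trans hSB)) (hcS.trans hSB) he
  have e2 : e = d := hB'.realComb_inj
    (heS.trans (Finset.inter_subset_right.trans hRB)) (hdR.trans hRB) (he.trans h)
  rw [← e1, e2]

/-- The function `f_α` on `N_ℝ` that is linear on every cone of the fan and takes the value `α v`
at each primitive ray generator `v`: if `x = ∑ c_v v`, where `c_v > 0` and `v` runs through the
generators of a cone of the fan, then `f_α(x) = ∑ c_v α_v`. (The value outside the support of the
fan is `0`.) -/
def plFun (X : SmoothFan N) (α : N → ℝ) (x : ℝ ⊗[ℤ] N) : ℝ :=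
  open Classical in
  if h : ∃ c : N →₀ ℝ, (∀ v, 0 ≤ c v) ∧ c.support ∈ X.cones ∧ realComb c = x then
    h.choose.sum fun v r => r * α v
  else 0

/-- `f_α` is linear on each cone, with the values `α v` at the generators. -/
theorem plFun_realComb (X : SmoothFan N) (α : N → ℝ) {S : Finset N} (hS : S ∈ X.cones)
    {c : N →₀ ℝ} (hc : ∀ v, 0 ≤ c v) (hcS : c.support ⊆ S) :
    X.plFun α (realComb c) = c.sum fun v r => r * α v := by
  have h : ∃ d : N →₀ ℝ, (∀ v, 0 ≤ d v) ∧ d.support ∈ X.cones ∧ realComb d = realComb c :=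
    ⟨c, hc, X.face_mem S hS _ hcS, rfl⟩
  rw [plFun, dif_pos h]
  have hs := h.choose_spec
  rw [X.realComb_inj hs.2.1 hS hs.1 hc subset_rfl hcS hs.2.2]

theorem plFun_ray (X : SmoothFan N) (α : N → ℝ) {v : N} (hv : v ∈ X.rays) :
    X.plFun α (1 ⊗ₜ v) = α v := by
  classical
  have := X.plFun_realComb α (S := {v}) hv (c := Finsupp.single v 1)
    (fun w => by rw [Finsupp.single_apply]; split_ifs <;> norm_num) Finsupp.support_single_subset
  simpa [realComb] using this

/-- The sum `e = ∑_{v ∈ T} v` of the generators of a cone `T` of dimension at least two is not a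
ray generator of the fan. -/
theorem sum_notMem (Y : SmoothFan N) {T : Finset N} (hT : T ∈ Y.cones) (h2 : 2 ≤ T.card)
    {R : Finset N} (hR : R ∈ Y.cones) : ∑ v ∈ T, v ∉ R := by
  classical
  intro he
  have h1 : realComb (Finsupp.single (∑ v ∈ T, v) (1 : ℝ)) =
      realComb (∑ v ∈ T, Finsupp.single v (1 : ℝ)) := by
    simp [realComb, TensorProduct.tmul_sum]
  have key := Y.realComb_inj hR hT
    (fun w => by rw [Finsupp.single_apply]; split_ifs <;> norm_num)
    (fun w => by
      rw [Finsupp.finsetSum_apply]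
      exact Finset.sum_nonneg fun i _ => by rw [Finsupp.single_apply]; split_ifs <;> norm_num)
    (Finsupp.support_single_subset.trans (by simpa using he))
    (by
      intro w hw
      by_contra hwT
      rw [Finsupp.mem_support_iff, Finsupp.finsetSum_apply] at hw
      exact hw (Finset.sum_eq_zero fun i hi => by
        rw [Finsupp.single_apply, if_neg]; rintro rfl; exact hwT hi)) h1
  have hle : T ⊆ {∑ v ∈ T, v} := by
    intro w hw
    have := DFunLike.congr_fun key w
    rw [Finsupp.finsetSum_apply] at this
    simp only [Finsupp.single_apply, Finset.sum_ite_eq', hw, if_true] at this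
    split_ifs at this with h
    · simp [h]
    · norm_num at this
  have := Finset.card_le_card hle
  simp at this
  omega

open Classical in
/-- The cones of the star subdivision along the cone `T`. -/
def starCones (Y : SmoothFan N) (T : Finset N) : Finset (Finset N) :=
  Y.cones.filter (fun S => ¬ T ⊆ S) ∪
    (Y.cones.filter (fun R => T ⊆ R)).biUnion
      (fun R => (insert (∑ v ∈ T, v) R).powerset.filter (fun S => ¬ T ⊆ S))

theorem mem_starCones (Y : SmoothFan N) (T S : Finset N) :
    S ∈ Y.starCones T ↔ (S ∈ Y.cones ∧ ¬ T ⊆ S) ∨ ∃ R ∈ Y.cones, T ⊆ R ∧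
      (S : Set N) ⊆ insert (∑ v ∈ T, v) (R : Set N) ∧ ¬ T ⊆ S := by
  classical
  simp only [starCones, Finset.mem_union, Finset.mem_filter, Finset.mem_biUnion,
    Finset.mem_powerset, and_assoc]
  simp only [← Finset.coe_subset, Finset.coe_insert]

theorem star_aux (Y : SmoothFan N) {T : Finset N} (hT : T ∈ Y.cones) (h2 : 2 ≤ T.card)
    {A : Finset N} (hA : A ∈ Y.starCones T) : ¬ T ⊆ A ∧ ∃ R ∈ Y.cones,
      (A : Set N) ⊆ insert (∑ v ∈ T, v) (R : Set N) ∧ (∑ v ∈ T, v ∈ A → T ⊆ R) := by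
  rcases (Y.mem_starCones T A).1 hA with ⟨h, hTA⟩ | ⟨R, hR, hTR, hAR, hTA⟩
  · exact ⟨hTA, A, h, Set.subset_insert _ _, fun he => absurd he (Y.sum_notMem hT h2 h)⟩
  · exact ⟨hTA, R, hR, hAR, fun _ => hTR⟩

open Classical in
/-- The expression of a point through the generators of `Y`, from one through the generators of
the star subdivision. -/
def oldComb (T : Finset N) (c : N →₀ ℝ) : N →₀ ℝ :=
  c.erase (∑ v ∈ T, v) + c (∑ v ∈ T, v) • ∑ w ∈ T, Finsupp.single w (1 : ℝ)

theorem realComb_oldComb (T : Finset N) (c : N →₀ ℝ) :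
    realComb (oldComb T c) = realComb c := by
  classical
  conv_rhs => rw [← Finsupp.erase_add_single (∑ v ∈ T, v) c]
  rw [oldComb, map_add, map_add, map_smul]
  congr 1
  simp [realComb, TensorProduct.tmul_sum, Finset.smul_sum]

theorem oldComb_apply (T : Finset N) (c : N →₀ ℝ) {v : N} (hv : v ≠ ∑ w ∈ T, w) :
    oldComb T c v = c v + (open Classical in if v ∈ T then c (∑ w ∈ T, w) else 0) := by
  classical
  rw [oldComb, Finsupp.add_apply, Finsupp.erase_ne hv, Finsupp.smul_apply,
    Finsupp.finsetSum_apply]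
  simp [Finsupp.single_apply]

theorem oldComb_apply_self (T : Finset N) (c : N →₀ ℝ) (hT : ∑ w ∈ T, w ∉ T) :
    oldComb T c (∑ w ∈ T, w) = 0 := by
  classical
  rw [oldComb, Finsupp.add_apply, Finsupp.erase_same, Finsupp.smul_apply,
    Finsupp.finsetSum_apply]
  simp [Finsupp.single_apply, hT]

theorem oldComb_nonneg (T : Finset N) {c : N →₀ ℝ} (hc : ∀ v, 0 ≤ c v) (hT : ∑ w ∈ T, w ∉ T)
    (v : N) : 0 ≤ oldComb T c v := by
  by_cases hv : v = ∑ w ∈ T, w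
  · rw [hv, oldComb_apply_self T c hT]
  · rw [oldComb_apply T c hv]
    have := hc v
    have := hc (∑ w ∈ T, w)
    split_ifs <;> linarith

theorem oldComb_support (T : Finset N) {c : N →₀ ℝ} {A R : Finset N}
    (hT : ∑ w ∈ T, w ∉ T) (hcA : c.support ⊆ A)
    (hAR : (A : Set N) ⊆ insert (∑ v ∈ T, v) (R : Set N)) (hTR : ∑ v ∈ T, v ∈ A → T ⊆ R) :
    (oldComb T c).support ⊆ R := by
  intro v hv
  rw [Finsupp.mem_support_iff] at hv
  have hne : v ≠ ∑ w ∈ T, w := by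
    rintro rfl
    exact hv (oldComb_apply_self T c hT)
  rw [oldComb_apply T c hne] at hv
  by_cases hcv : c v = 0
  · rw [hcv, zero_add] at hv
    split_ifs at hv with hvT
    · exact hTR (hcA (Finsupp.mem_support_iff.2 hv)) hvT
    · exact absurd rfl hv
  · have := hAR (hcA (Finsupp.mem_support_iff.2 hcv))
    simpa [hne] using this

theorem star_inj (Y : SmoothFan N) {T : Finset N} (hT : T ∈ Y.cones) (h2 : 2 ≤ T.card)
    {A B : Finset N} (hA : A ∈ Y.starCones T) (hB : B ∈ Y.starCones T)
    {c d : N →₀ ℝ} (hc : ∀ v, 0 ≤ c v) (hd : ∀ v, 0 ≤ d v) (hcA : c.support ⊆ A)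
    (hdB : d.support ⊆ B) (h : realComb c = realComb d) : c = d := by
  classical
  have heT := Y.sum_notMem hT h2 hT
  obtain ⟨hTA, R, hR, hAR, hTR⟩ := Y.star_aux hT h2 hA
  obtain ⟨hTB, R', hR', hBR, hTR'⟩ := Y.star_aux hT h2 hB
  have key : oldComb T c = oldComb T d := Y.realComb_inj hR hR'
    (oldComb_nonneg T hc heT) (oldComb_nonneg T hd heT)
    (oldComb_support T heT hcA hAR hTR) (oldComb_support T heT hdB hBR hTR')
    (by rw [realComb_oldComb, realComb_oldComb, h])
  have hval : ∀ v, v ≠ ∑ w ∈ T, w → c v + (if v ∈ T then c (∑ w ∈ T, w) else 0) =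
      d v + (if v ∈ T then d (∑ w ∈ T, w) else 0) := by
    intro v hv
    have := DFunLike.congr_fun key v
    rw [oldComb_apply T c hv, oldComb_apply T d hv] at this
    convert this
  obtain ⟨w, hwT, hwA⟩ := Finset.not_subset.1 hTA
  obtain ⟨w', hwT', hwB⟩ := Finset.not_subset.1 hTB
  have hcw : c w = 0 := by
    by_contra hne; exact hwA (hcA (Finsupp.mem_support_iff.2 hne))
  have hdw : d w' = 0 := by
    by_contra hne; exact hwB (hdB (Finsupp.mem_support_iff.2 hne))
  have e1 := hval w (fun hh => heT (hh ▸ hwT))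
  have e2 := hval w' (fun hh => heT (hh ▸ hwT'))
  rw [if_pos hwT, if_pos hwT, hcw] at e1
  rw [if_pos hwT', if_pos hwT', hdw] at e2
  have hee : c (∑ w ∈ T, w) = d (∑ w ∈ T, w) := by
    have := hd w
    have := hc w'
    linarith
  ext v
  by_cases hv : v = ∑ w ∈ T, w
  · rw [hv, hee]
  · have := hval v hv
    rw [hee] at this
    linarith

/-- The star subdivision of a smooth fan along a cone `T` of dimension at least two: the ray through
the sum `e` of the generators of `T` is added, and each cone `R ⊇ T` is replaced by the cones on
the sets `S ⊆ R ∪ {e}` that do not contain `T`. This is the fan of the blow-up of the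
smooth toric variety of `Y` along the torus-invariant subvariety (orbit closure) `V(T)`. -/
def blowUp (Y : SmoothFan N) (T : Finset N) (hT : T ∈ Y.cones) (h2 : 2 ≤ T.card) :
    SmoothFan N where
  cones := Y.starCones T
  empty_mem := by
    refine (Y.mem_starCones T ∅).2 (Or.inl ⟨Y.empty_mem, fun h => ?_⟩)
    have := Finset.card_le_card h
    rw [Finset.card_empty] at this
    omega
  face_mem := by
    intro S hS R hRS
    rcases (Y.mem_starCones T S).1 hS with ⟨h, hTS⟩ | ⟨Q, hQ, hTQ, hSQ, hTS⟩
    · exact (Y.mem_starCones T R).2 (Or.inl ⟨Y.face_mem S h R hRS, fun h' => hTS (h'.trans hRS)⟩)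
    · exact (Y.mem_starCones T R).2 (Or.inr ⟨Q, hQ, hTQ,
        (Finset.coe_subset.2 hRS).trans hSQ, fun h' => hTS (h'.trans hRS)⟩)
  smooth := by
    classical
    intro A hA
    rcases (Y.mem_starCones T A).1 hA with ⟨h, -⟩ | ⟨R, hR, hTR, hAR, hTA⟩
    · exact Y.smooth A h
    obtain ⟨B, hB, hRB⟩ := Y.smooth R hR
    obtain ⟨w, hwT, hwA⟩ := Finset.not_subset.1 hTA
    have hwB : w ∈ B := hRB (hTR hwT)
    have hspan : Submodule.span ℤ ((insert (∑ v ∈ T, v) (B.erase w) : Finset N) : Set N) = ⊤ := by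
      rw [eq_top_iff, ← hB.2, Submodule.span_le]
      intro v hv
      by_cases hvw : v = w
      · have hsum : v = ∑ x ∈ T, x - ∑ x ∈ T.erase w, x := by
          rw [← Finset.add_sum_erase T (fun x => x) hwT, hvw]
          abel
        rw [SetLike.mem_coe, hsum]
        refine Submodule.sub_mem _ (Submodule.subset_span (by simp)) (Submodule.sum_mem _ ?_)
        intro x hx
        refine Submodule.subset_span ?_
        have hx' := Finset.mem_erase.1 hx
        simp only [Finset.coe_insert, Finset.coe_erase]
        exact Or.inr ⟨hRB (hTR hx'.2), by simpa using hx'.1⟩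
      · refine Submodule.subset_span ?_
        simp only [Finset.coe_insert, Finset.coe_erase]
        exact Or.inr ⟨hv, by simpa using hvw⟩
    refine ⟨insert (∑ v ∈ T, v) (B.erase w), ⟨?_, hspan⟩, ?_⟩
    · refine linearIndependent_of_top_le_span_of_card_le_finrank
        (ι := ((insert (∑ v ∈ T, v) (B.erase w) : Finset N) : Set N))
        (b := fun i => id (i : N)) ?_ ?_
      · simp only [id, Subtype.range_coe]
        exact hspan.ge
      · rw [← hB.card_eq]
        simp only [Finset.coe_sort_coe, Fintype.card_coe]
        refine (Finset.card_insert_le _ _).trans ?_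
        rw [Finset.card_erase_add_one hwB]
    · intro v hv
      rcases hAR hv with h | h
      · simp [h]
      · refine Finset.mem_insert_of_mem (Finset.mem_erase.2 ⟨?_, hRB h⟩)
        rintro rfl
        exact hwA hv
  inter := by
    classical
    intro A hA B hB
    apply le_antisymm
    · intro x hx
      obtain ⟨⟨c, hc, hcA, h1⟩, ⟨d, hd, hdB, h2'⟩⟩ :=
        And.intro (mem_latticeCone.1 (Submodule.mem_inf.1 hx).1)
          (mem_latticeCone.1 (Submodule.mem_inf.1 hx).2)
      have hcd : c = d := Y.star_inj hT h2 hA hB hc hd hcA hdB (h1.trans h2'.symm)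
      exact mem_latticeCone.2 ⟨c, hc, Finset.subset_inter hcA (hcd ▸ hdB), h1⟩
    · intro x hx
      obtain ⟨c, hc, hcAB, h1⟩ := mem_latticeCone.1 hx
      exact Submodule.mem_inf.2
        ⟨mem_latticeCone.2 ⟨c, hc, hcAB.trans Finset.inter_subset_left, h1⟩,
          mem_latticeCone.2 ⟨c, hc, hcAB.trans Finset.inter_subset_right, h1⟩⟩

/-- `IsIteratedBlowUp Y X`: the toric variety of `X` is obtained from that of `Y` by a finite
sequence of toric blow-ups. -/
inductive IsIteratedBlowUp (Y : SmoothFan N) : SmoothFan N → Prop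
  | refl : IsIteratedBlowUp Y Y
  | step (X : SmoothFan N) (T : Finset N) (hT : T ∈ X.cones) (h2 : 2 ≤ T.card) :
      IsIteratedBlowUp Y X → IsIteratedBlowUp Y (X.blowUp T hT h2)

/-- The pull-back `β = μ^*α` of the coefficients `α` on the rays of `Y`: for a ray generator `b` of
the fan of `X`, `β_b = f_α(b)`, where `f_α` is the piecewise linear function of `α` on the fan
of `Y`. -/
def pullback (Y : SmoothFan N) (α : N → ℝ) : N → ℝ :=
  fun b => Y.plFun α (1 ⊗ₜ b)

/-- The denominators `θ(x_{S,v}) θ(a_v z)` of the elliptic sum do not vanish at `(u, z)`. -/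
def IsRegularAt (X : SmoothFan N) (a : N → ℝ) (τ z : ℂ) (u : ℂ ⊗[ℤ] N) : Prop :=
  ∀ S ∈ X.maxCones, ∀ v ∈ S,
    thetaOdd (evalC (dualForm S v) u) τ ≠ 0 ∧ thetaOdd (a v * z) τ ≠ 0

/-- The sum over the `n`-dimensional cones `S` of the fan of
`∏_{v ∈ S} θ(x_{S,v} + a_v z) / (θ(x_{S,v}) θ(a_v z))`, where the `x_{S,v}` are the linear forms
dual to the generators of `S`, as a function of `u ∈ N_ℂ` and `z`. -/
def ellipticSum (X : SmoothFan N) (a : N → ℝ) (τ z : ℂ) (u : ℂ ⊗[ℤ] N) : ℂ :=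
  ∑ S ∈ X.maxCones, ∏ v ∈ S, thetaQuot τ (evalC (dualForm S v) u) (a v * z)

end SmoothFan

end

/-!
Both identities come from one addition formula for the theta function.

*The addition formula.* Multiplying two theta series and substituting `p = m + n + 1`,
`q = m - n` gives `θ(x + y) θ(x - y) = A(x) B(y) - B(x) A(y)`, with `A` and `B` the sums over even
and over odd indices (`thetaOdd_add_mul_thetaOdd_sub`). So these products are the `2 × 2` minors of
a matrix, and their Plücker relation is the three-term identity `thetaOdd_three_term`. In terms of
`Q(x, w) = θ(x + w) / (θ(x) θ(w))` this is Fay's identity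
`Q(x, w) Q(y, v) = Q(y - x, v) Q(x, w + v) + Q(x - y, w) Q(y, w + v)` (`thetaQuot_mul_thetaQuot`).

*Part (2)* is the case `w_j = (α_j - 1) z` of the partial fraction identity
`∑ i, (∏ j ≠ i, Q(u_j - u_i, w_j)) Q(u_i, ∑ j, w_j) = ∏ j, Q(u_j, w_j)`, which follows from Fay's
identity by induction on the number of variables. The induction divides by `θ` of partial sums of
the `w_j`, whence a limit argument at the end (`sum_prod_thetaQuot`).

*Part (1)* for a single blow-up along `T` is the same identity. A maximal cone `R ⊇ T` is replaced
by the cones `R \ {w} ∪ {e}`, `w ∈ T`, `e = ∑ v ∈ T, v`, whose dual bases are `x_w`, `x_v - x_w` for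
the other `v ∈ T`, and `x_v` for `v ∉ T` (`SmoothFan.dualForm_blowUp`), and the coefficient of `e`
is the sum of those of `T`, as `f_α` is linear on the cone of the original fan that contains `T`
(`SmoothFan.pullback_sum`). Along a chain of blow-ups the denominators of the intermediate
fans may vanish at `u`. The coefficients are harmless there, since rays are never removed; the
dual forms are dealt with by moving `u` in a generic direction and passing to the limit
(`SmoothFan.IsIteratedBlowUp.ellipticSum_pullback`).
-/

noncomputable section

/-! ### Addition formulas for the theta function -/

/-- The partial series of `∑ p, exp (πi p² τ / 2 + 2πi p x)` over the even integers `p`. -/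
def thetaEvenPart (τ x : ℂ) : ℂ := jacobiTheta₂ (2 * x) (2 * τ)

/-- The partial series of `∑ p, exp (πi p² τ / 2 + 2πi p x)` over the odd integers `p`. -/
def thetaOddPart (τ x : ℂ) : ℂ :=
  Complex.exp (Real.pi * Complex.I * τ / 2 + 2 * Real.pi * Complex.I * x) *
    jacobiTheta₂ (2 * x + τ) (2 * τ)

theorem hasSum_thetaEvenPart {τ : ℂ} (hτ : 0 < τ.im) (x : ℂ) :
    HasSum (fun k : ℤ => Complex.exp (Real.pi * Complex.I * (2 * k) ^ 2 * τ / 2 +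
      2 * Real.pi * Complex.I * (2 * k) * x)) (thetaEvenPart τ x) := by
  have h2 : 0 < (2 * τ).im := by simpa using hτ
  refine (hasSum_jacobiTheta₂_term (2 * x) h2).congr_fun fun k => ?_
  rw [jacobiTheta₂_term]
  congr 1
  ring

theorem hasSum_thetaOddPart {τ : ℂ} (hτ : 0 < τ.im) (x : ℂ) :
    HasSum (fun k : ℤ => Complex.exp (Real.pi * Complex.I * (2 * k + 1) ^ 2 * τ / 2 +
      2 * Real.pi * Complex.I * (2 * k + 1) * x)) (thetaOddPart τ x) := by
  have h2 : 0 < (2 * τ).im := by simpa using hτ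
  refine ((hasSum_jacobiTheta₂_term (2 * x + τ) h2).mul_left _).congr_fun fun k => ?_
  rw [jacobiTheta₂_term, ← Complex.exp_add]
  congr 1
  ring

/-- The substitution `p = m + n + 1`, `q = m - n` on `ℤ × ℤ`: the pairs `(p, q)` have opposite
parities, and the two summands of the source hold the pairs `(2k, 2l + 1)` and `(2k + 1, 2l)`. -/
theorem bijective_sum_sub_parity : Function.Bijective
    (Sum.elim (fun p : ℤ × ℤ => (p.1 + p.2, p.1 - p.2 - 1))
      (fun p : ℤ × ℤ => (p.1 + p.2, p.1 - p.2))) := by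
  constructor
  · rintro (⟨a, b⟩ | ⟨a, b⟩) (⟨c, d⟩ | ⟨c, d⟩) h <;>
      simp only [Sum.elim_inl, Sum.elim_inr, Prod.mk.injEq, Sum.inl.injEq, Sum.inr.injEq,
        reduceCtorEq] at h ⊢ <;> omega
  · rintro ⟨m, n⟩
    rcases Int.even_or_odd' (m + n) with ⟨k, hk | hk⟩
    · exact ⟨Sum.inr (k, m - k), by
        simp only [Sum.elim_inr, Prod.mk.injEq]; omega⟩
    · exact ⟨Sum.inl (k + 1, m - k - 1), by
        simp only [Sum.elim_inl, Prod.mk.injEq]; omega⟩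

/-- The product `θ(x + y) θ(x - y)` is a `2 × 2` determinant in functions of `x` and of `y`. -/
theorem thetaOdd_add_mul_thetaOdd_sub {τ : ℂ} (hτ : 0 < τ.im) (x y : ℂ) :
    thetaOdd (x + y) τ * thetaOdd (x - y) τ =
      thetaEvenPart τ x * thetaOddPart τ y - thetaOddPart τ x * thetaEvenPart τ y := by
  have mulSum : ∀ {f g : ℤ → ℂ} {a b : ℂ}, HasSum f a → HasSum g b →
      HasSum (fun p : ℤ × ℤ => f p.1 * g p.2) (a * b) := fun hf hg =>
    hf.mul hg (summable_mul_of_summable_norm hf.summable.norm hg.summable.norm)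
  have h1 := mulSum (hasSum_thetaOdd (x + y) τ hτ) (hasSum_thetaOdd (x - y) τ hτ)
  have h2 := mulSum (hasSum_thetaEvenPart hτ x) (hasSum_thetaOddPart hτ y)
  have h3 := (mulSum (hasSum_thetaOddPart hτ x) (hasSum_thetaEvenPart hτ y)).neg
  rw [← (Equiv.ofBijective _ bijective_sum_sub_parity).hasSum_iff] at h1
  rw [sub_eq_add_neg]
  refine h1.unique (HasSum.sum (h2.congr_fun ?_) (h3.congr_fun ?_))
  · rintro ⟨k, l⟩
    have hs : (-1 : ℂ) ^ (k + l) * (-1) ^ (k - l - 1) = -1 := by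
      rw [← zpow_add₀ (by norm_num), show k + l + (k - l - 1) = 2 * (k - 1) + 1 by ring,
        zpow_add₀ (by norm_num), zpow_mul]
      simp
    simp only [Function.comp_apply, Equiv.ofBijective_apply, Sum.elim_inl]
    rw [mul_mul_mul_comm, mul_mul_mul_comm ((-1 : ℂ) ^ _), hs, ← Complex.exp_add,
      ← Complex.exp_add]
    simp only [neg_mul_neg, Complex.I_mul_I, neg_one_mul, one_mul]
    congr 1
    push_cast
    ring
  · rintro ⟨k, l⟩
    have hs : (-1 : ℂ) ^ (k + l) * (-1) ^ (k - l) = 1 := by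
      rw [← zpow_add₀ (by norm_num), show k + l + (k - l) = 2 * k by ring, zpow_mul]
      simp
    simp only [Function.comp_apply, Equiv.ofBijective_apply, Sum.elim_inr]
    rw [mul_mul_mul_comm, mul_mul_mul_comm ((-1 : ℂ) ^ _), hs, ← Complex.exp_add,
      ← Complex.exp_add]
    simp only [neg_mul_neg, Complex.I_mul_I, one_mul, neg_one_mul]
    congr 2
    push_cast
    ring

/-- The three-term identity for the theta function: the Plücker relation between the `2 × 2`
minors of a `2 × 4` matrix, for the determinants of `thetaOdd_add_mul_thetaOdd_sub`. -/
theorem thetaOdd_three_term {τ : ℂ} (hτ : 0 < τ.im) (a b c d : ℂ) :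
    thetaOdd (a + b) τ * thetaOdd (a - b) τ * (thetaOdd (c + d) τ * thetaOdd (c - d) τ) -
      thetaOdd (a + c) τ * thetaOdd (a - c) τ * (thetaOdd (b + d) τ * thetaOdd (b - d) τ) +
      thetaOdd (a + d) τ * thetaOdd (a - d) τ * (thetaOdd (b + c) τ * thetaOdd (b - c) τ) = 0 := by
  simp only [thetaOdd_add_mul_thetaOdd_sub hτ]
  ring

theorem thetaOdd_neg {τ : ℂ} (hτ : 0 < τ.im) (t : ℂ) : thetaOdd (-t) τ = -thetaOdd t τ := by
  have h := (Equiv.subLeft (-1 : ℤ)).hasSum_iff.2 (hasSum_thetaOdd (-t) τ hτ)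
  refine h.unique ((hasSum_thetaOdd t τ hτ).neg.congr_fun fun n => ?_)
  have hs : (-1 : ℂ) ^ (-1 - n) = -(-1) ^ n := by
    rw [zpow_sub₀ (by norm_num)]
    rcases Int.even_or_odd n with hn | hn
    · simp [hn.neg_one_zpow]
    · simp [hn.neg_one_zpow]
  simp only [Function.comp_apply, Equiv.subLeft_apply]
  rw [hs, neg_mul (_ ^ _), mul_neg]
  congr 4
  push_cast
  ring

/-- Fay's identity: a product of two quotients `θ(x + w) / (θ(x) θ(w))` splits into two terms with
the sum of the second arguments. -/
theorem thetaQuot_mul_thetaQuot {τ : ℂ} (hτ : 0 < τ.im) {x y w v : ℂ}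
    (hx : thetaOdd x τ ≠ 0) (hy : thetaOdd y τ ≠ 0) (hxy : thetaOdd (y - x) τ ≠ 0)
    (hw : thetaOdd w τ ≠ 0) (hv : thetaOdd v τ ≠ 0) (hwv : thetaOdd (w + v) τ ≠ 0) :
    thetaQuot τ x w * thetaQuot τ y v =
      thetaQuot τ (y - x) v * thetaQuot τ x (w + v) +
        thetaQuot τ (x - y) w * thetaQuot τ y (w + v) := by
  have key := thetaOdd_three_term hτ (w + (x + v) / 2) ((x + v) / 2) (y + (v - x) / 2)
    ((x - v) / 2)
  rw [show w + (x + v) / 2 + (x + v) / 2 = x + (w + v) by ring,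
    show w + (x + v) / 2 - (x + v) / 2 = w by ring,
    show y + (v - x) / 2 + (x - v) / 2 = y by ring,
    show y + (v - x) / 2 - (x - v) / 2 = y - x + v by ring,
    show w + (x + v) / 2 + (y + (v - x) / 2) = y + (w + v) by ring,
    show w + (x + v) / 2 - (y + (v - x) / 2) = x - y + w by ring,
    show (x + v) / 2 + (x - v) / 2 = x by ring, show (x + v) / 2 - (x - v) / 2 = v by ring,
    show w + (x + v) / 2 + (x - v) / 2 = x + w by ring,
    show w + (x + v) / 2 - (x - v) / 2 = w + v by ring,
    show (x + v) / 2 + (y + (v - x) / 2) = y + v by ring,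
    show (x + v) / 2 - (y + (v - x) / 2) = -(y - x) by ring, thetaOdd_neg hτ] at key
  have e : thetaOdd (x - y) τ = -thetaOdd (y - x) τ := by
    rw [← thetaOdd_neg hτ, neg_sub]
  simp only [thetaQuot, e]
  field_simp
  linear_combination -key

/-! ### Zeros and continuity -/

theorem differentiable_thetaOdd {τ : ℂ} (hτ : 0 < τ.im) :
    Differentiable ℂ (fun t => thetaOdd t τ) := by
  intro t
  have h : DifferentiableAt ℂ (fun t : ℂ => jacobiTheta₂ (t + τ / 2 + 1 / 2) τ) t :=
    DifferentiableAt.comp t (differentiableAt_jacobiTheta₂_fst _ hτ) (by fun_prop)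
  unfold thetaOdd
  fun_prop

theorem eventually_thetaOdd_ne_zero {τ : ℂ} (hτ : 0 < τ.im) (hne : ∃ t, thetaOdd t τ ≠ 0)
    (a : ℂ) {b : ℂ} (hb : b ≠ 0) :
    ∀ᶠ s in nhdsWithin (0 : ℂ) {0}ᶜ, thetaOdd (a + s * b) τ ≠ 0 := by
  have hd : Differentiable ℂ (fun s : ℂ => thetaOdd (a + s * b) τ) :=
    (differentiable_thetaOdd hτ).comp (by fun_prop)
  have ha : AnalyticOnNhd ℂ (fun s : ℂ => thetaOdd (a + s * b) τ) Set.univ :=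
    fun s _ => hd.analyticAt s
  rcases (ha 0 trivial).eventually_eq_zero_or_eventually_ne_zero with h | h
  · obtain ⟨t, ht⟩ := hne
    have h0 := ha.eqOn_zero_of_preconnected_of_eventuallyEq_zero isPreconnected_univ
      (Set.mem_univ 0) h (Set.mem_univ ((t - a) / b))
    simp only [Pi.zero_apply, div_mul_cancel₀ _ hb, add_sub_cancel] at h0
    exact absurd h0 ht
  · exact h

theorem tendsto_thetaQuot {τ : ℂ} (hτ : 0 < τ.im) {ι : Type*} {l : Filter ι} {f g : ι → ℂ}
    {x w : ℂ} (hf : Filter.Tendsto f l (nhds x)) (hg : Filter.Tendsto g l (nhds w))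
    (hx : thetaOdd x τ ≠ 0) (hw : thetaOdd w τ ≠ 0) :
    Filter.Tendsto (fun i => thetaQuot τ (f i) (g i)) l (nhds (thetaQuot τ x w)) := by
  have hc := (differentiable_thetaOdd hτ).continuous
  exact ((hc.tendsto _).comp (hf.add hg)).div
    (((hc.tendsto _).comp hf).mul ((hc.tendsto _).comp hg)) (mul_ne_zero hx hw)

/-! ### The partial fraction identity -/

/-- The partial fraction identity when the theta function does not vanish at any partial sum of
the `w i`. Multiplying by one more factor, Fay's identity splits each term in two; the second
parts add up to the new term by the identity for the differences `u i - u a`. -/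
theorem sum_prod_thetaQuot_of_generic {τ : ℂ} (hτ : 0 < τ.im) {ι : Type*} [DecidableEq ι]
    (w : ι → ℂ) {s : Finset ι} (hs : s.Nonempty) :
    (∀ t ⊆ s, t.Nonempty → thetaOdd (∑ j ∈ t, w j) τ ≠ 0) →
    ∀ u : ι → ℂ, (∀ i ∈ s, thetaOdd (u i) τ ≠ 0) →
    (∀ i ∈ s, ∀ j ∈ s, j ≠ i → thetaOdd (u j - u i) τ ≠ 0) →
    ∑ i ∈ s, (∏ j ∈ s.erase i, thetaQuot τ (u j - u i) (w j)) *
      thetaQuot τ (u i) (∑ j ∈ s, w j) = ∏ j ∈ s, thetaQuot τ (u j) (w j) := by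
  induction hs using Finset.Nonempty.cons_induction with
  | singleton a => intros; simp
  | cons a s ha hs ih =>
    intro hw u hu huu
    have hsub : s ⊆ s.cons a ha := Finset.subset_cons ha
    have haS : a ∈ s.cons a ha := Finset.mem_cons_self a s
    have hws : ∀ t ⊆ s, t.Nonempty → thetaOdd (∑ j ∈ t, w j) τ ≠ 0 :=
      fun t ht => hw t (ht.trans hsub)
    have ih1 := ih hws u (fun i hi => hu i (hsub hi))
      (fun i hi j hj => huu i (hsub hi) j (hsub hj))
    have ih2 := ih hws (fun i => u i - u a)
      (fun i hi => huu a haS i (hsub hi) (fun h => ha (h ▸ hi)))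
      (fun i hi j hj hij => by simpa using huu i (hsub hi) j (hsub hj) hij)
    simp only [sub_sub_sub_cancel_right] at ih2
    rw [Finset.prod_cons, ← ih1, Finset.sum_cons, Finset.cons_eq_insert,
      Finset.erase_insert ha, Finset.sum_insert ha, ← ih2, Finset.sum_mul, Finset.mul_sum,
      ← Finset.sum_add_distrib]
    refine Finset.sum_congr rfl fun i hi => ?_
    have hia : a ≠ i := fun h => ha (h ▸ hi)
    have hwa := hw {a} (by simp) (by simp)
    rw [Finset.sum_singleton] at hwa
    have hW := hw _ subset_rfl ⟨a, haS⟩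
    rw [Finset.sum_cons, add_comm] at hW
    have fay := thetaQuot_mul_thetaQuot hτ (hu i (hsub hi)) (hu a haS)
      (huu i (hsub hi) a haS hia) (hws s subset_rfl hs) hwa hW
    rw [Finset.erase_insert_of_ne hia, Finset.prod_insert (fun h => ha (Finset.mem_erase.1 h).2),
      add_comm (w a)]
    linear_combination (-∏ j ∈ s.erase i, thetaQuot τ (u j - u i) (w j)) * fay

/-- The partial fraction identity for theta quotients. The partial sums of the `w i` become
generic under the shift `w i + ε`, and both sides are continuous in `ε`. -/
theorem sum_prod_thetaQuot {τ : ℂ} (hτ : 0 < τ.im) {ι : Type*} [DecidableEq ι]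
    {s : Finset ι} (hs : s.Nonempty) (u w : ι → ℂ) (hu : ∀ i ∈ s, thetaOdd (u i) τ ≠ 0)
    (huu : ∀ i ∈ s, ∀ j ∈ s, j ≠ i → thetaOdd (u j - u i) τ ≠ 0)
    (hw : ∀ i ∈ s, thetaOdd (w i) τ ≠ 0) (hW : thetaOdd (∑ j ∈ s, w j) τ ≠ 0) :
    ∑ i ∈ s, (∏ j ∈ s.erase i, thetaQuot τ (u j - u i) (w j)) *
      thetaQuot τ (u i) (∑ j ∈ s, w j) = ∏ j ∈ s, thetaQuot τ (u j) (w j) := by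
  have ht : ∀ i, Filter.Tendsto (fun ε : ℂ => w i + ε) (nhdsWithin (0 : ℂ) {0}ᶜ) (nhds (w i)) :=
    fun i => tendsto_nhdsWithin_of_tendsto_nhds
      (Continuous.tendsto' (by fun_prop) _ _ (add_zero _))
  have hgen : ∀ᶠ ε in nhdsWithin (0 : ℂ) {0}ᶜ, ∀ t ∈ s.powerset, t.Nonempty →
      thetaOdd (∑ j ∈ t, (w j + ε)) τ ≠ 0 := by
    rw [Filter.eventually_all_finset]
    intro t _
    by_cases hn : t.Nonempty
    · filter_upwards [eventually_thetaOdd_ne_zero hτ ⟨_, hW⟩ (∑ j ∈ t, w j)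
        (b := (t.card : ℂ)) (by exact_mod_cast hn.card_ne_zero)] with ε hε _
      rwa [Finset.sum_add_distrib, Finset.sum_const, nsmul_eq_mul, mul_comm]
    · exact Filter.Eventually.of_forall fun _ h => absurd h hn
  refine tendsto_nhds_unique_of_eventuallyEq
    (l := nhdsWithin (0 : ℂ) {0}ᶜ)
    (f := fun ε => ∑ i ∈ s, (∏ j ∈ s.erase i, thetaQuot τ (u j - u i) (w j + ε)) *
      thetaQuot τ (u i) (∑ j ∈ s, (w j + ε)))
    (g := fun ε => ∏ j ∈ s, thetaQuot τ (u j) (w j + ε)) ?_ ?_ ?_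
  · refine tendsto_finsetSum _ fun i hi => (tendsto_finsetProd _ fun j hj => ?_).mul
      (tendsto_thetaQuot hτ tendsto_const_nhds (tendsto_finsetSum _ fun j _ => ht j) (hu i hi) hW)
    have hj' := Finset.mem_erase.1 hj
    exact tendsto_thetaQuot hτ tendsto_const_nhds (ht j) (huu i hi j hj'.2 hj'.1) (hw j hj'.2)
  · exact tendsto_finsetProd _ fun j hj =>
      tendsto_thetaQuot hτ tendsto_const_nhds (ht j) (hu j hj) (hw j hj)
  · filter_upwards [hgen] with ε hε
    exact sum_prod_thetaQuot_of_generic hτ (fun j => w j + ε) hs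
      (fun t ht => hε t (Finset.mem_powerset.2 ht)) u hu huu

/-! ### The sum over the maximal cones of a blow-up -/

theorem evalC_sub {N : Type*} [AddCommGroup N] (x y : N →ₗ[ℤ] ℤ) (u : ℂ ⊗[ℤ] N) :
    evalC (x - y) u = evalC x u - evalC y u := by
  rw [evalC, LinearMap.lTensor_sub, LinearMap.sub_apply, map_sub]
  rfl

/-- A linear form with the values of the dual basis on a basis `S` is the dual form. -/
theorem dualForm_eq {N : Type*} [AddCommGroup N] {S : Finset N} (hS : IsLatticeBasis S) {v : N}
    (hv : v ∈ S) (x : N →ₗ[ℤ] ℤ) (h1 : x v = 1) (h0 : ∀ w ∈ S, w ≠ v → x w = 0) :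
    dualForm S v = x := by
  refine LinearMap.ext_on hS.2 fun w hw => ?_
  rw [dualForm_apply hS hv hw]
  split_ifs with h
  · rw [h, h1]
  · rw [h0 w hw h]

namespace SmoothFan

variable {N : Type*} [AddCommGroup N]

theorem mem_maxCones {X : SmoothFan N} {S : Finset N} :
    S ∈ X.maxCones ↔ S ∈ X.cones ∧ S.card = Module.finrank ℤ N := by
  rw [maxCones, Finset.mem_filter]

theorem card_le_finrank (X : SmoothFan N) {S : Finset N} (hS : S ∈ X.cones) :
    S.card ≤ Module.finrank ℤ N := by
  obtain ⟨B, hB, hSB⟩ := X.smooth S hS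
  exact (Finset.card_le_card hSB).trans hB.card_eq.le

theorem mem_maxCones_blowUp [DecidableEq N] (Y : SmoothFan N) {T : Finset N} (hT : T ∈ Y.cones)
    (h2 : 2 ≤ T.card) {S : Finset N} :
    S ∈ (Y.blowUp T hT h2).maxCones ↔ (S ∈ Y.maxCones ∧ ¬ T ⊆ S) ∨
      ∃ R ∈ Y.maxCones, T ⊆ R ∧ ∃ w ∈ T, S = insert (∑ v ∈ T, v) (R.erase w) := by
  have heT : ∀ {R}, R ∈ Y.cones → ∑ v ∈ T, v ∉ R := fun hR => Y.sum_notMem hT h2 hR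
  rw [mem_maxCones]
  change S ∈ Y.starCones T ∧ _ ↔ _
  rw [mem_starCones]
  constructor
  · rintro ⟨⟨hS, hTS⟩ | ⟨R, hR, hTR, hSR, hTS⟩, hc⟩
    · exact Or.inl ⟨mem_maxCones.2 ⟨hS, hc⟩, hTS⟩
    · obtain ⟨w, hwT, hwS⟩ := Finset.not_subset.1 hTS
      have hsub : S ⊆ insert (∑ v ∈ T, v) (R.erase w) := by
        intro v hv
        rcases hSR hv with h | h
        · exact Finset.mem_insert.2 (Or.inl h)
        · exact Finset.mem_insert_of_mem (Finset.mem_erase.2 ⟨fun h' => hwS (h' ▸ hv), h⟩)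
      have hcard : (insert (∑ v ∈ T, v) (R.erase w)).card = R.card := by
        rw [Finset.card_insert_of_notMem (fun h => heT hR (Finset.mem_erase.1 h).2),
          Finset.card_erase_add_one (hTR hwT)]
      have hle := Y.card_le_finrank hR
      have hle' := Finset.card_le_card hsub
      have heq := Finset.eq_of_subset_of_card_le hsub (by omega)
      exact Or.inr ⟨R, mem_maxCones.2 ⟨hR, by omega⟩, hTR, w, hwT, heq⟩
  · rintro (⟨hS, hTS⟩ | ⟨R, hR, hTR, w, hwT, rfl⟩)
    · exact ⟨Or.inl ⟨(mem_maxCones.1 hS).1, hTS⟩, (mem_maxCones.1 hS).2⟩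
    · obtain ⟨hR, hc⟩ := mem_maxCones.1 hR
      refine ⟨Or.inr ⟨R, hR, hTR, ?_, fun h => ?_⟩, ?_⟩
      · rw [Finset.coe_insert]
        exact Set.insert_subset_insert (Finset.coe_subset.2 (Finset.erase_subset _ _))
      · rcases Finset.mem_insert.1 (h hwT) with h' | h'
        · exact heT hT (h' ▸ hwT)
        · exact (Finset.mem_erase.1 h').1 rfl
      · rw [Finset.card_insert_of_notMem (fun h => heT hR (Finset.mem_erase.1 h).2),
          Finset.card_erase_add_one (hTR hwT), hc]

/-- The pair of a cone `R` containing `T` and a generator `w ∈ T` can be recovered from the cone of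
the star subdivision that replaces `w` by `∑ v ∈ T, v`. -/
theorem insert_sum_erase_inj [DecidableEq N] (Y : SmoothFan N) {T : Finset N} (hT : T ∈ Y.cones)
    (h2 : 2 ≤ T.card) {R R' : Finset N} (hR : R ∈ Y.cones) (hR' : R' ∈ Y.cones) (hTR : T ⊆ R)
    (hTR' : T ⊆ R') {w w' : N} (hw : w ∈ T) (hw' : w' ∈ T)
    (h : insert (∑ v ∈ T, v) (R.erase w) = insert (∑ v ∈ T, v) (R'.erase w')) :
    R = R' ∧ w = w' := by
  have he : R.erase w = R'.erase w' := by
    have := congrArg (fun S => S.erase (∑ v ∈ T, v)) h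
    simpa only [Finset.erase_insert (fun h => Y.sum_notMem hT h2 hR (Finset.mem_erase.1 h).2),
      Finset.erase_insert (fun h => Y.sum_notMem hT h2 hR' (Finset.mem_erase.1 h).2)] using this
  have hww : w = w' := by
    by_contra hne
    have : w ∈ R'.erase w' := Finset.mem_erase.2 ⟨hne, hTR' hw⟩
    rw [← he] at this
    exact (Finset.mem_erase.1 this).1 rfl
  refine ⟨?_, hww⟩
  rw [← Finset.insert_erase (hTR hw), he, hww, Finset.insert_erase (hTR' hw')]

theorem sum_maxCones_blowUp [DecidableEq N] (Y : SmoothFan N) {T : Finset N} (hT : T ∈ Y.cones)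
    (h2 : 2 ≤ T.card) (f : Finset N → ℂ) :
    ∑ S ∈ (Y.blowUp T hT h2).maxCones, f S =
      ∑ S ∈ Y.maxCones with ¬ T ⊆ S, f S +
        ∑ R ∈ Y.maxCones with T ⊆ R, ∑ w ∈ T, f (insert (∑ v ∈ T, v) (R.erase w)) := by
  have hU : (Y.blowUp T hT h2).maxCones = (Y.maxCones.filter fun S => ¬ T ⊆ S) ∪
      ((Y.maxCones.filter fun R => T ⊆ R) ×ˢ T).image
        fun p => insert (∑ v ∈ T, v) (p.1.erase p.2) := by
    ext S
    rw [mem_maxCones_blowUp, Finset.mem_union, Finset.mem_filter, Finset.mem_image]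
    refine or_congr Iff.rfl ⟨?_, ?_⟩
    · rintro ⟨R, hR, hTR, w, hw, rfl⟩
      exact ⟨(R, w), Finset.mem_product.2 ⟨Finset.mem_filter.2 ⟨hR, hTR⟩, hw⟩, rfl⟩
    · rintro ⟨⟨R, w⟩, h, rfl⟩
      obtain ⟨h, hw⟩ := Finset.mem_product.1 h
      obtain ⟨hR, hTR⟩ := Finset.mem_filter.1 h
      exact ⟨R, hR, hTR, w, hw, rfl⟩
  rw [hU, Finset.sum_union, Finset.sum_image, Finset.sum_product]
  · rintro ⟨R, w⟩ hp ⟨R', w'⟩ hp' h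
    obtain ⟨hp, hw⟩ := Finset.mem_product.1 hp
    obtain ⟨hp', hw'⟩ := Finset.mem_product.1 hp'
    obtain ⟨hR, hTR⟩ := Finset.mem_filter.1 hp
    obtain ⟨hR', hTR'⟩ := Finset.mem_filter.1 hp'
    obtain ⟨rfl, rfl⟩ := Y.insert_sum_erase_inj hT h2 (mem_maxCones.1 hR).1 (mem_maxCones.1 hR').1
      hTR hTR' hw hw' h
    rfl
  · rw [Finset.disjoint_left]
    intro S hS hS'
    obtain ⟨p, -, rfl⟩ := Finset.mem_image.1 hS'
    exact Y.sum_notMem hT h2 (mem_maxCones.1 (Finset.mem_filter.1 hS).1).1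
      (Finset.mem_insert_self _ _)

/-- The dual bases of the new cones: if `x_v` is the dual basis of `R`, then that of
`insert (∑ v ∈ T, v) (R.erase w)` consists of `x_w`, of `x_v - x_w` for the other `v ∈ T`, and of
`x_v` for `v ∉ T`. -/
theorem dualForm_blowUp [DecidableEq N] (Y : SmoothFan N) {T : Finset N} (hT : T ∈ Y.cones)
    (h2 : 2 ≤ T.card) {R : Finset N} (hR : R ∈ Y.maxCones) (hTR : T ⊆ R) {w : N} (hw : w ∈ T) :
    dualForm (insert (∑ v ∈ T, v) (R.erase w)) (∑ v ∈ T, v) = dualForm R w ∧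
    (∀ v ∈ T.erase w, dualForm (insert (∑ v ∈ T, v) (R.erase w)) v = dualForm R v - dualForm R w) ∧
    (∀ v ∈ R \ T, dualForm (insert (∑ v ∈ T, v) (R.erase w)) v = dualForm R v) := by
  have hbR := Y.isLatticeBasis_of_mem_maxCones hR
  have hS := (Y.blowUp T hT h2).isLatticeBasis_of_mem_maxCones
    ((Y.mem_maxCones_blowUp hT h2).2 (Or.inr ⟨R, hR, hTR, w, hw, rfl⟩))
  have happ : ∀ v ∈ R, ∀ v' ∈ R, dualForm R v v' = if v' = v then 1 else 0 := fun v hv v' hv' => by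
    convert dualForm_apply hbR hv hv'
  have hsum : ∀ v ∈ R, dualForm R v (∑ v ∈ T, v) = if v ∈ T then 1 else 0 := fun v hv => by
    rw [map_sum, Finset.sum_congr rfl fun v' hv' => happ v hv v' (hTR hv'),
      Finset.sum_ite_eq']
  have hwR := hTR hw
  refine ⟨?_, fun v hv => ?_, fun v hv => ?_⟩
  · refine dualForm_eq hS (Finset.mem_insert_self _ _) _ (by rw [hsum w hwR, if_pos hw]) ?_
    intro v hv hne
    have hv' := Finset.mem_erase.1 ((Finset.mem_insert.1 hv).resolve_left hne)
    rw [happ w hwR v hv'.2, if_neg hv'.1]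
  · obtain ⟨hvw, hvT⟩ := Finset.mem_erase.1 hv
    have hvR := hTR hvT
    refine dualForm_eq hS (Finset.mem_insert_of_mem (Finset.mem_erase.2 ⟨hvw, hvR⟩)) _ ?_ ?_
    · rw [LinearMap.sub_apply, happ v hvR v hvR, happ w hwR v hvR, if_pos rfl, if_neg hvw, sub_zero]
    · intro v' hv' hne
      rw [LinearMap.sub_apply]
      rcases Finset.mem_insert.1 hv' with rfl | hv'
      · rw [hsum v hvR, hsum w hwR, if_pos hvT, if_pos hw, sub_self]
      · obtain ⟨h1, h3⟩ := Finset.mem_erase.1 hv'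
        rw [happ v hvR v' h3, happ w hwR v' h3, if_neg hne, if_neg h1, sub_self]
  · obtain ⟨hvR, hvT⟩ := Finset.mem_sdiff.1 hv
    refine dualForm_eq hS (Finset.mem_insert_of_mem (Finset.mem_erase.2
      ⟨by rintro rfl; exact hvT hw, hvR⟩)) _ (by rw [happ v hvR v hvR, if_pos rfl]) ?_
    intro v' hv' hne
    rcases Finset.mem_insert.1 hv' with rfl | hv'
    · rw [hsum v hvR, if_neg hvT]
    · rw [happ v hvR v' (Finset.mem_erase.1 hv').2, if_neg hne]

/-- Invariance under one blow-up. The terms of the cones that replace `R ⊇ T` add up to the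
term of `R`: after cancelling the factors of the generators outside `T`, this is the partial
fraction identity for the dual forms `x_v`, `v ∈ T`. -/
theorem ellipticSum_blowUp (Y : SmoothFan N) {T : Finset N} (hT : T ∈ Y.cones)
    (h2 : 2 ≤ T.card) {a : N → ℝ} (ha : a (∑ v ∈ T, v) = ∑ v ∈ T, a v) {τ : ℂ} (hτ : 0 < τ.im)
    {z : ℂ} {u : ℂ ⊗[ℤ] N} (hX : (Y.blowUp T hT h2).IsRegularAt a τ z u)
    (hY : Y.IsRegularAt a τ z u) :
    (Y.blowUp T hT h2).ellipticSum a τ z u = Y.ellipticSum a τ z u := by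
  classical
  rw [ellipticSum, ellipticSum, sum_maxCones_blowUp,
    ← Finset.sum_filter_not_add_sum_filter Y.maxCones (fun S => T ⊆ S)]
  congr 1
  refine Finset.sum_congr rfl fun R hR => ?_
  obtain ⟨hR, hTR⟩ := Finset.mem_filter.1 hR
  have hXR : ∀ w ∈ T, _ := fun w hw =>
    hX _ ((Y.mem_maxCones_blowUp hT h2).2 (Or.inr ⟨R, hR, hTR, w, hw, rfl⟩))
  have hTne : T.Nonempty := Finset.card_pos.1 (by omega)
  have hprod : ∀ w ∈ T, ∏ v ∈ insert (∑ v ∈ T, v) (R.erase w), thetaQuot τ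
      (evalC (dualForm (insert (∑ v ∈ T, v) (R.erase w)) v) u) (a v * z) =
      (∏ v ∈ R \ T, thetaQuot τ (evalC (dualForm R v) u) (a v * z)) *
      ((∏ v ∈ T.erase w, thetaQuot τ (evalC (dualForm R v) u - evalC (dualForm R w) u) (a v * z)) *
        thetaQuot τ (evalC (dualForm R w) u) (∑ v ∈ T, a v * z)) := by
    intro w hw
    obtain ⟨d1, d2, d3⟩ := Y.dualForm_blowUp hT h2 hR hTR hw
    have hdiff : R.erase w \ T.erase w = R \ T := by
      ext v
      simp only [Finset.mem_sdiff, Finset.mem_erase]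
      constructor
      · rintro ⟨⟨h1, h3⟩, h4⟩
        exact ⟨h3, fun h => h4 ⟨h1, h⟩⟩
      · rintro ⟨h1, h3⟩
        exact ⟨⟨fun h => h3 (h ▸ hw), h1⟩, fun h => h3 h.2⟩
    rw [Finset.prod_insert (fun h => Y.sum_notMem hT h2 (mem_maxCones.1 hR).1
        (Finset.mem_erase.1 h).2), ← Finset.prod_sdiff (Finset.erase_subset_erase w hTR), hdiff,
      d1, ha, Complex.ofReal_sum, Finset.sum_mul,
      Finset.prod_congr rfl fun v hv => by rw [d3 v hv],
      Finset.prod_congr (s₁ := T.erase w) rfl fun v hv => by rw [d2 v hv, evalC_sub]]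
    ring
  rw [Finset.sum_congr rfl hprod, ← Finset.mul_sum, ← Finset.prod_sdiff hTR]
  congr 1
  refine sum_prod_thetaQuot hτ hTne (fun v => evalC (dualForm R v) u) (fun v => a v * z)
    (fun v hv => (hY R hR v (hTR hv)).1) ?_ (fun v hv => (hY R hR v (hTR hv)).2) ?_
  · intro w hw v hv hvw
    have h := (hXR w hw v (Finset.mem_insert_of_mem (Finset.mem_erase.2 ⟨hvw, hTR hv⟩))).1
    rwa [(Y.dualForm_blowUp hT h2 hR hTR hw).2.1 v (Finset.mem_erase.2 ⟨hvw, hv⟩),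
      evalC_sub] at h
  · obtain ⟨w, hw⟩ := hTne
    have h := (hXR w hw _ (Finset.mem_insert_self _ _)).2
    rwa [ha, Complex.ofReal_sum, Finset.sum_mul] at h

end SmoothFan

/-! ### Generic points of `N_ℂ` -/

/-- The form `evalC x` on `N_ℂ` as a `ℂ`-linear map. -/
def evalCLinear {N : Type*} [AddCommGroup N] (x : N →ₗ[ℤ] ℤ) : (ℂ ⊗[ℤ] N) →ₗ[ℂ] ℂ :=
  (TensorProduct.AlgebraTensorModule.rid ℤ ℂ ℂ).toLinearMap ∘ₗ x.baseChange ℂ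

theorem evalC_eq_evalCLinear {N : Type*} [AddCommGroup N] (x : N →ₗ[ℤ] ℤ) (u : ℂ ⊗[ℤ] N) :
    evalC x u = evalCLinear x u := rfl

theorem exists_evalCLinear_ne_zero {N : Type*} [AddCommGroup N] {F : Finset (N →ₗ[ℤ] ℤ)}
    (hF : ∀ x ∈ F, x ≠ 0) : ∃ h : ℂ ⊗[ℤ] N, ∀ x ∈ F, evalCLinear x h ≠ 0 := by
  obtain ⟨h, hh⟩ := Module.Dual.exists_forall_ne_zero_of_forall_exists
    (fun x : F => (evalCLinear x.1 : Module.Dual ℂ (ℂ ⊗[ℤ] N))) fun x => by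
      obtain ⟨m, hm⟩ := DFunLike.ne_iff.1 (hF x.1 x.2)
      refine ⟨1 ⊗ₜ m, ?_⟩
      rw [evalCLinear]
      simpa using hm
  exact ⟨h, fun x hx => hh ⟨x, hx⟩⟩

namespace SmoothFan

variable {N : Type*} [AddCommGroup N]

open Classical in
/-- The forms of the dual bases of the maximal cones. -/
def dualForms (X : SmoothFan N) : Finset (N →ₗ[ℤ] ℤ) :=
  X.maxCones.biUnion fun S => S.image (dualForm S)

theorem dualForm_mem_dualForms (X : SmoothFan N) {S : Finset N} (hS : S ∈ X.maxCones) {v : N}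
    (hv : v ∈ S) : dualForm S v ∈ X.dualForms := by
  classical
  exact Finset.mem_biUnion.2 ⟨S, hS, Finset.mem_image.2 ⟨v, hv, rfl⟩⟩

theorem ne_zero_of_mem_dualForms (X : SmoothFan N) {x : N →ₗ[ℤ] ℤ} (hx : x ∈ X.dualForms) :
    x ≠ 0 := by
  classical
  obtain ⟨S, hS, hx⟩ := Finset.mem_biUnion.1 hx
  obtain ⟨v, hv, rfl⟩ := Finset.mem_image.1 hx
  intro h
  have := dualForm_apply (X.isLatticeBasis_of_mem_maxCones hS) hv hv
  simp [h] at this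

theorem tendsto_ellipticSum (X : SmoothFan N) {a : N → ℝ} {τ : ℂ} (hτ : 0 < τ.im) {z : ℂ}
    {u : ℂ ⊗[ℤ] N} (hX : X.IsRegularAt a τ z u) (h : ℂ ⊗[ℤ] N) :
    Filter.Tendsto (fun t : ℂ => X.ellipticSum a τ z (u + t • h)) (nhdsWithin 0 {0}ᶜ)
      (nhds (X.ellipticSum a τ z u)) := by
  refine tendsto_finsetSum _ fun S hS => tendsto_finsetProd _ fun v hv =>
    tendsto_thetaQuot hτ ?_ tendsto_const_nhds (hX S hS v hv).1 (hX S hS v hv).2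
  simp only [evalC_eq_evalCLinear, map_add, map_smul, smul_eq_mul]
  exact tendsto_nhdsWithin_of_tendsto_nhds
    (Continuous.tendsto' (by fun_prop) _ _ (by simp))

/-! ### Iterated blow-ups -/

/-- A property of the generators of the maximal cones passes from a blow-up to the original fan:
no such generator is lost in a star subdivision. -/
theorem forall_maxCones_of_blowUp (Y : SmoothFan N) {T : Finset N} (hT : T ∈ Y.cones)
    (h2 : 2 ≤ T.card) {P : N → Prop} (h : ∀ S ∈ (Y.blowUp T hT h2).maxCones, ∀ v ∈ S, P v) :
    ∀ S ∈ Y.maxCones, ∀ v ∈ S, P v := by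
  classical
  intro S hS v hv
  by_cases hTS : T ⊆ S
  · obtain ⟨w, hw, hwv⟩ := Finset.exists_mem_ne (show 1 < T.card by omega) v
    exact h _ ((Y.mem_maxCones_blowUp hT h2).2 (Or.inr ⟨S, hS, hTS, w, hw, rfl⟩)) v
      (Finset.mem_insert_of_mem (Finset.mem_erase.2 ⟨hwv.symm, hv⟩))
  · exact h S ((Y.mem_maxCones_blowUp hT h2).2 (Or.inl ⟨hS, hTS⟩)) v hv

/-- The fan of an iterated blow-up refines the original fan. -/
theorem IsIteratedBlowUp.exists_mem_latticeCone {Y X : SmoothFan N} (h : IsIteratedBlowUp Y X) :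
    ∀ S ∈ X.cones, ∃ R ∈ Y.cones, ∀ v ∈ S, (1 : ℝ) ⊗ₜ[ℤ] v ∈ latticeCone R := by
  induction h with
  | refl => exact fun S hS => ⟨S, hS, fun v hv => Submodule.subset_span ⟨v, hv, rfl⟩⟩
  | step X T hT h2 _ ih =>
    intro S hS
    obtain ⟨-, Q, hQ, hSQ, hTQ⟩ := X.star_aux hT h2 hS
    obtain ⟨R, hR, hQR⟩ := ih Q hQ
    refine ⟨R, hR, fun v hv => ?_⟩
    rcases hSQ hv with rfl | h
    · rw [TensorProduct.tmul_sum]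
      exact Submodule.sum_mem _ fun v' hv' => hQR v' (hTQ hv hv')
    · exact hQR v h

/-- The pull-back coefficients are additive on the cones of an iterated blow-up, since each of
these lies in a domain of linearity of `f_α`. -/
theorem pullback_sum {Y X : SmoothFan N} (h : IsIteratedBlowUp Y X) (α : N → ℝ) {T : Finset N}
    (hT : T ∈ X.cones) : Y.pullback α (∑ v ∈ T, v) = ∑ v ∈ T, Y.pullback α v := by
  classical
  obtain ⟨R, hR, hTR⟩ := h.exists_mem_latticeCone T hT
  choose! c hc0 hcR hc using fun v hv => mem_latticeCone.1 (hTR v hv)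
  have hv : ∀ v ∈ T, Y.pullback α v = Finsupp.linearCombination ℝ α (c v) := fun v hv => by
    rw [pullback, ← hc v hv, Y.plFun_realComb α hR (hc0 v hv) (hcR v hv),
      Finsupp.linearCombination_apply]
    rfl
  have hs : (1 : ℝ) ⊗ₜ[ℤ] (∑ v ∈ T, v) = realComb (∑ v ∈ T, c v) := by
    rw [TensorProduct.tmul_sum, map_sum]
    exact (Finset.sum_congr rfl hc).symm
  rw [Finset.sum_congr rfl hv, ← map_sum, pullback, hs, Y.plFun_realComb α hR,
    Finsupp.linearCombination_apply]
  · rfl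
  · intro v
    rw [Finsupp.finsetSum_apply]
    exact Finset.sum_nonneg fun i hi => hc0 i hi v
  · exact Finsupp.support_finsetSum.trans (Finset.biUnion_subset.2 hcR)

/-- The elliptic sums of a fan and of an iterated blow-up agree off the zeros of `θ(x)`, where `x`
runs through finitely many non-zero forms: those of all fans of the chain. -/
theorem IsIteratedBlowUp.exists_finset_ellipticSum_eq {Y X : SmoothFan N}
    (h : IsIteratedBlowUp Y X) (α : N → ℝ) {τ : ℂ} (hτ : 0 < τ.im) (z : ℂ) :
    ∃ F : Finset (N →ₗ[ℤ] ℤ), (∀ x ∈ F, x ≠ 0) ∧ ∀ u : ℂ ⊗[ℤ] N,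
      (∀ x ∈ F, thetaOdd (evalC x u) τ ≠ 0) →
      (∀ S ∈ X.maxCones, ∀ v ∈ S, thetaOdd (Y.pullback α v * z) τ ≠ 0) →
      X.ellipticSum (Y.pullback α) τ z u = Y.ellipticSum (Y.pullback α) τ z u := by
  classical
  induction h with
  | refl => exact ⟨∅, by simp, fun _ _ _ => rfl⟩
  | step X T hT h2 hX ih =>
    obtain ⟨F, hF0, hF⟩ := ih
    refine ⟨F ∪ X.dualForms ∪ (X.blowUp T hT h2).dualForms, fun x hx => ?_, fun u hu hz => ?_⟩
    · simp only [Finset.mem_union] at hx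
      rcases hx with (hx | hx) | hx
      · exact hF0 x hx
      · exact X.ne_zero_of_mem_dualForms hx
      · exact (X.blowUp T hT h2).ne_zero_of_mem_dualForms hx
    · have hzX := X.forall_maxCones_of_blowUp hT h2
        (P := fun v => thetaOdd (Y.pullback α v * z) τ ≠ 0) hz
      rw [X.ellipticSum_blowUp hT h2 (pullback_sum hX α hT) hτ, hF u _ hzX]
      · exact fun x hx => hu x (Finset.mem_union_left _ (Finset.mem_union_left _ hx))
      · exact fun S hS v hv => ⟨hu _ (Finset.mem_union_right _
          ((X.blowUp T hT h2).dualForm_mem_dualForms hS hv)), hz S hS v hv⟩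
      · exact fun S hS v hv => ⟨hu _ (Finset.mem_union_left _ (Finset.mem_union_right _
          (X.dualForm_mem_dualForms hS hv))), hzX S hS v hv⟩

/-- The degenerate case that no maximal cone has a generator (rank zero, or no maximal cones at
all); here regularity at `(u, z)` is no condition. -/
theorem IsIteratedBlowUp.ellipticSum_eq_of_maxCones_trivial {Y X : SmoothFan N}
    (h : IsIteratedBlowUp Y X) (α : N → ℝ) {τ : ℂ} (hτ : 0 < τ.im) (z : ℂ) (u : ℂ ⊗[ℤ] N)
    (h0 : ∀ S ∈ X.maxCones, ∀ v ∈ S, False) :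
    X.ellipticSum (Y.pullback α) τ z u = Y.ellipticSum (Y.pullback α) τ z u := by
  induction h with
  | refl => rfl
  | step X T hT h2 hX ih =>
    have h0X := X.forall_maxCones_of_blowUp hT h2 (P := fun _ => False) h0
    rw [X.ellipticSum_blowUp hT h2 (pullback_sum hX α hT) hτ
      (fun S hS v hv => (h0 S hS v hv).elim) (fun S hS v hv => (h0X S hS v hv).elim), ih h0X]

theorem IsIteratedBlowUp.ellipticSum_pullback {Y X : SmoothFan N}
    (h : IsIteratedBlowUp Y X) (α : N → ℝ) {τ : ℂ} (hτ : 0 < τ.im) {z : ℂ} {u : ℂ ⊗[ℤ] N}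
    (hX : X.IsRegularAt (Y.pullback α) τ z u) (hY : Y.IsRegularAt α τ z u) :
    X.ellipticSum (Y.pullback α) τ z u = Y.ellipticSum α τ z u := by
  have hα : ∀ S ∈ Y.maxCones, ∀ v ∈ S, Y.pullback α v = α v := fun S hS v hv =>
    Y.plFun_ray α (Y.face_mem S (mem_maxCones.1 hS).1 {v} (by simpa using hv))
  have hsum : Y.ellipticSum α τ z u = Y.ellipticSum (Y.pullback α) τ z u :=
    Finset.sum_congr rfl fun S hS => Finset.prod_congr rfl fun v hv => by rw [hα S hS v hv]
  have hY' : Y.IsRegularAt (Y.pullback α) τ z u := fun S hS v hv => by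
    rw [hα S hS v hv]
    exact hY S hS v hv
  rw [hsum]
  by_cases hne : ∃ t, thetaOdd t τ ≠ 0
  · obtain ⟨F, hF0, hF⟩ := h.exists_finset_ellipticSum_eq α hτ z
    obtain ⟨d, hd⟩ := exists_evalCLinear_ne_zero hF0
    refine tendsto_nhds_unique_of_eventuallyEq (X.tendsto_ellipticSum hτ hX d)
      (Y.tendsto_ellipticSum hτ hY' d) ?_
    have hev : ∀ᶠ t in nhdsWithin (0 : ℂ) {0}ᶜ, ∀ x ∈ F, thetaOdd (evalC x (u + t • d)) τ ≠ 0 := by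
      rw [Filter.eventually_all_finset]
      intro x hx
      filter_upwards [eventually_thetaOdd_ne_zero hτ hne (evalC x u) (hd x hx)] with t ht
      simpa [evalC_eq_evalCLinear] using ht
    filter_upwards [hev] with t ht
    exact hF _ ht fun S hS v hv => (hX S hS v hv).2
  -- If `θ(·, τ)` were identically zero, regularity would leave no generators at all.
  · exact h.ellipticSum_eq_of_maxCones_trivial α hτ z u
      fun S hS v hv => hne ⟨_, (hX S hS v hv).2⟩

end SmoothFan

end

theorem mainTheorem4 :
    (∀ (N : Type*) [AddCommGroup N] [Module.Free ℤ N] [Module.Finite ℤ N]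
      (Y X : SmoothFan N), Y.IsComplete → SmoothFan.IsIteratedBlowUp Y X →
      ∀ α : N → ℝ, (∀ v ∈ Y.rays, α v < 0) →
      ∀ τ : ℂ, 0 < τ.im → ∀ (z : ℂ) (u : ℂ ⊗[ℤ] N),
        X.IsRegularAt (Y.pullback α) τ z u → Y.IsRegularAt α τ z u →
        X.ellipticSum (Y.pullback α) τ z u = Y.ellipticSum α τ z u) ∧
    (∀ (n : ℕ), 1 ≤ n → ∀ α : Fin n → ℝ, (∀ i, α i < 1) →
      ∀ α₀ : ℝ, α₀ = ∑ i, α i + (1 - n) →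
      ∀ τ : ℂ, 0 < τ.im → ∀ (z : ℂ) (u : Fin n → ℂ),
        (∀ i, thetaOdd (u i) τ ≠ 0) →
        (∀ i j, j ≠ i → thetaOdd (u j - u i) τ ≠ 0) →
        (∀ i, thetaOdd ((α i - 1) * z) τ ≠ 0) →
        thetaOdd ((α₀ - 1) * z) τ ≠ 0 →
        ∑ i, (∏ j ∈ Finset.univ.erase i, thetaQuot τ (u j - u i) ((α j - 1) * z)) *
            thetaQuot τ (u i) ((α₀ - 1) * z) =
          ∏ j, thetaQuot τ (u j) ((α j - 1) * z)) := by
  refine ⟨fun N _ _ _ Y X _ h α _ τ hτ z u hX hY => h.ellipticSum_pullback α hτ hX hY, ?_⟩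
  intro n hn α _ α₀ hα τ hτ z u hu huu hw hW
  have hsum : ((α₀ : ℂ) - 1) * z = ∑ j, ((α j : ℂ) - 1) * z := by
    rw [← Finset.sum_mul, Finset.sum_sub_distrib, hα]
    push_cast
    simp only [Finset.sum_const, Finset.card_univ, Fintype.card_fin, nsmul_eq_mul, mul_one]
    ring
  rw [hsum] at hW ⊢
  exact sum_prod_thetaQuot hτ ⟨⟨0, hn⟩, Finset.mem_univ _⟩ u (fun j => (α j - 1) * z)
    (fun i _ => hu i) (fun i _ j _ => huu i j) (fun i _ => hw i) hW
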